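/- Let $R$ be a commutative ring with identity, $n\ge 0$ an integer, and $\Omega=R[x_1,\dots,x_n]$. For $f\in\Omega$ and $\alpha\in\mathbb N^n$ let $f_{[\alpha]}$ be the coefficient of $x_1^{\alpha_1}\cdots x_n^{\alpha_n}$ in $f$, and $\operatorname{supp}(f)=\{\alpha\in\mathbb N^n : f_{[\alpha]}\ne 0\}$. Order $\mathbb N^n$ coordinatewise, and for $A,B\subseteq\mathbb N^n$ put $\Delta(A)=\{\beta\in\mathbb N^n : \beta\le\alpha\text{ for some }\alpha\in A\}$, $A+B=\{\alpha+\beta : \alpha\in A,\ \beta\in B\}$, and let $\max(A)$ be the set of maximal elements of $A$. A set $X\subseteq R$ satisfies Condition (D) if for all $a\neq b$ in $X$ the element $b-a$ is not a zero divisor, i.e. there is no $w\ne 0$ in $R$ with $(b-a)w=0$. For each $k\in\{1,\dots,n\}$ let $S_k\subseteq R$ be a finite (possibly empty) set with multiplicities $\psi_k(u)\in\mathbb Z^{+}$ for $u\in S_k$, and let $g_k=\prod_{u\in S_k}(x_k-u)^{\psi_k(u)}$. For $t\in\mathbb N=\{0,1,2,\dots\}$ let $\mathcal I_t(g_1,\dots,g_n)$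 be the ideal of $\Omega$ generated by all products $\prod_{k=1}^n g_k^{\alpha_k}$ with $\alpha\in\mathbb N^n$, $\sum_i\alpha_i=t$. For $f\in\Omega$ consider the condition $$(\ast)_t\qquad f(x_1+a_1,\dots,x_n+a_n)_{[\beta]}=0\ \text{ for all } a\in\prod_{i=1}^n S_i \text{ and all } \beta\in\mathbb N^n \text{ with } \sum_{i=1}^n\left\lfloor\frac{\beta_i}{\psi_i(a_i)}\right\rfloor\le t-1 .$$ **(1)** Suppose every $S_k$ satisfies Condition (D). Then for all $t\in\mathbb N$ and $f\in\Omega$: $f\in\mathcal I_t(g_1,\dots,g_n)$ if and only if $f$ satisfies $(\ast)_t$. **(2)** Suppose every $S_k$ satisfies Condition (D), let $t\in\mathbb N$, and let $f\in\Omega$ satisfy $(\ast)_t$. Then there are polynomials $p(\alpha)\in\Omega$, one for each $\alpha\in\mathbb N^n$ with $\sum_i\alpha_i=t$, such that $$f=\sum_{\alpha\in\mathbb N^n,\ \sum_i\alpha_i=t}p(\alpha)\prod_{k=1}^n g_k^{\alpha_k},$$ and $\operatorname{supp}(p(\alpha))+\operatorname{supp}\bigl(\prod_{k=1}^n g_k^{\alpha_k}\bigr)\subseteq\Delta(\operatorname{supp}(f))$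 for each such $\alpha$. Moreover, for every $\beta\in\max(\operatorname{supp}(f))$ there is $\gamma\in\mathbb N^n$ with $\sum_i\gamma_i=t$ and $\bigl(\sum_{u\in S_k}\psi_k(u)\bigr)\gamma_k\le\beta_k$ for all $k\in\{1,\dots,n\}$. **(3)** Suppose $\prod_{i=1}^n S_i\ne\emptyset$, let $t\ge 1$, and suppose that every $f\in\Omega$ satisfying $(\ast)_t$ lies in $\mathcal I_t(g_1,\dots,g_n)$. Then every $S_k$ satisfies Condition (D). -/

import Mathlib

open MvPolynomial
open scoped Pointwise

namespace MultisetNSS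

/-- Condition (D): differences of distinct elements of `X` are not zero divisors. -/
def ConditionD {R : Type*} [CommRing R] (X : Set R) : Prop :=
  ∀ a ∈ X, ∀ b ∈ X, a ≠ b → ¬ ∃ w : R, w ≠ 0 ∧ (b - a) * w = 0

/-- The shifted polynomial `f(x₁ + a₁, …, xₙ + aₙ)`. -/
noncomputable def shift {R : Type*} [CommRing R] {n : ℕ} (a : Fin n → R)
    (f : MvPolynomial (Fin n) R) : MvPolynomial (Fin n) R :=
  aeval (fun i => X i + C (a i)) f

/-- The exponents `α ∈ ℕⁿ` with `α₁ + ⋯ + αₙ = t`. -/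
def expsOfSum (n t : ℕ) : Finset (Fin n →₀ ℕ) :=
  Finset.finsuppAntidiag Finset.univ t

theorem mem_expsOfSum {n t : ℕ} {α : Fin n →₀ ℕ} : α ∈ expsOfSum n t ↔ ∑ i, α i = t := by
  simp [expsOfSum, Finset.mem_finsuppAntidiag]

/-- The product `g₁ ^ α₁ ⋯ gₙ ^ αₙ`. -/
noncomputable def prodPow {R : Type*} [CommRing R] {n : ℕ} (g : Fin n → MvPolynomial (Fin n) R)
    (α : Fin n →₀ ℕ) : MvPolynomial (Fin n) R :=
  ∏ k, g k ^ α k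

/-- The ideal `I_t(g₁, …, gₙ)` generated by the products `g₁ ^ α₁ ⋯ gₙ ^ αₙ`
with `α₁ + ⋯ + αₙ = t`. -/
noncomputable def idealI {R : Type*} [CommRing R] {n : ℕ} (t : ℕ) (g : Fin n → MvPolynomial (Fin n) R) :
    Ideal (MvPolynomial (Fin n) R) :=
  Ideal.span {q | ∃ α : Fin n →₀ ℕ, ∑ i, α i = t ∧ q = prodPow g α}

/-- The polynomials `g_k = ∏_{u ∈ S_k} (x_k - u) ^ ψ_k(u)` attached to multisets `(S_k, ψ_k)`. -/
noncomputable def multisetPoly {R : Type*} [CommRing R] {n : ℕ} (S : Fin n → Finset R)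
    (ψ : Fin n → R → ℕ) (k : Fin n) : MvPolynomial (Fin n) R :=
  ∏ u ∈ S k, (X k - C u) ^ ψ k u

/-- `f` vanishes to order `t` on the multisets: `f(x + a)_[β] = 0` for all `a ∈ S₁ × ⋯ × Sₙ` and
all `β ∈ ℕⁿ` with `∑ ⌊β_i / ψ_i(a_i)⌋ ≤ t - 1`. The subtraction is taken in `ℤ`, so that there is
no such `β` when `t = 0`. -/
def Vanishes {R : Type*} [CommRing R] {n : ℕ} (S : Fin n → Finset R) (ψ : Fin n → R → ℕ)
    (t : ℕ) (f : MvPolynomial (Fin n) R) : Prop :=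
  ∀ a : Fin n → R, (∀ i, a i ∈ S i) → ∀ β : Fin n →₀ ℕ,
    ((∑ i, β i / ψ i (a i) : ℕ) : ℤ) ≤ (t : ℤ) - 1 → coeff β (shift a f) = 0

end MultisetNSS

open MultisetNSS

/-! ### Periodic enumerations of multisets -/

namespace MultisetNSS

/-! Newton interpolation with repeated nodes. Enumerate the `k`-th multiset periodically as `u_0,
u_1, …` with period `d_k = ∑ ψ_k`, and let `N_m = ∏_{j<m} (x - u_j)`, so that `N_{m + d_k q} = g_k^q
N_m`. Let `e_m` be the number of `j < m` with `u_j = u_m`. At `u_m`, the Taylor coefficient of order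
`e_m` vanishes for `N_{m'}` with `m' > m`; for `N_m` it is a product of differences of distinct
nodes, regular by (D). Also `⌊e_m / ψ(u_m)⌋ = ⌊m / d_k⌋`. These facts form `exists_newton_basis`.

Products `B_β` of Newton polynomials in separate variables expand `f` with indices in `Δ(supp f)`
(`exists_expansion`). By triangularity, `(∗)_t` kills the coefficients with `∑ ⌊β_i / d_i⌋ < t`;
each other `B_β` contains a product of `g_k` of total exponent `t`. This gives
`exists_representation`, support bound included.

For (3), if `w (b - a) = 0` with `w ≠ 0`, then `w g_k^t / (x_k - b)` satisfies `(∗)_t`, but its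
degree is too small for it to lie in the ideal. -/

/-- A periodic sequence of which each period enumerates a given multiset. -/
theorem exists_periodic_enumeration {A : Type*} (M : Multiset A) (hM : 0 < M.card) :
    ∃ u : ℕ → A, Function.Periodic u M.card ∧ (Multiset.range M.card).map u = M := by
  have hl : M.toList.length = M.card := M.length_toList
  refine ⟨fun m => M.toList[m % M.card]'(hl.symm ▸ Nat.mod_lt _ hM), fun m => by simp, ?_⟩
  conv_rhs => rw [← M.coe_toList]
  rw [← Multiset.coe_range, Multiset.map_coe]
  congr 1
  apply List.ext_getElem
  · simp
  · intro i h₁ h₂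
    rw [hl] at h₂
    simp [Nat.mod_eq_of_lt h₂]

open Classical in
theorem count_periodic {A : Type*} {u : ℕ → A} {d : ℕ} (hu : Function.Periodic u d) (x : A)
    (q r : ℕ) :
    Nat.count (u · = x) (d * q + r) = q * Nat.count (u · = x) d + Nat.count (u · = x) r := by
  induction q with
  | zero => simp
  | succ q ih =>
    have h : d * (q + 1) + r = d + (d * q + r) := by ring
    have hs : ∀ k, u (d + k) = u k := fun k => by rw [add_comm]; exact hu k
    rw [h, Nat.count_add]
    simp only [hs, ih]
    ring

-- Full periods contribute equally many occurrences of `u m`; the partial one contributes fewer, as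
-- it stops just before the occurrence at position `m % d`.
open Classical in
theorem count_div_of_periodic {A : Type*} {u : ℕ → A} {d : ℕ} (hd : 0 < d)
    (hu : Function.Periodic u d) (m : ℕ) :
    Nat.count (u · = u m) m / Nat.count (u · = u m) d = m / d := by
  have hum : u (m % d) = u m := hu.map_mod_nat m
  have hlt : Nat.count (u · = u m) (m % d) < Nat.count (u · = u m) d :=
    Nat.count_strict_mono hum (Nat.mod_lt _ hd)
  have h := count_periodic hu (u m) (m / d) (m % d)
  rw [Nat.div_add_mod] at h
  rw [h, mul_comm, Nat.mul_add_div (by omega), Nat.div_eq_of_lt hlt, add_zero]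

/-! ### Newton polynomials and their Taylor coefficients -/

section Univariate

variable {R : Type*} [CommRing R]

/-- The Newton polynomial `∏_{j < m} (X - u_j)`. -/
noncomputable def newton (u : ℕ → R) (m : ℕ) : Polynomial R :=
  ∏ j ∈ Finset.range m, (Polynomial.X - Polynomial.C (u j))

theorem newton_monic (u : ℕ → R) (m : ℕ) : (newton u m).Monic :=
  Polynomial.monic_prod_of_monic _ _ fun _ _ => Polynomial.monic_X_sub_C _

theorem newton_natDegree_le (u : ℕ → R) (m : ℕ) : (newton u m).natDegree ≤ m := by
  refine (Polynomial.natDegree_prod_le _ _).trans ?_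
  refine (Finset.sum_le_sum fun j _ => Polynomial.natDegree_X_sub_C_le _).trans ?_
  simp

theorem newton_coeff_self (u : ℕ → R) (m : ℕ) : (newton u m).coeff m = 1 := by
  nontriviality R
  have h : (newton u m).natDegree = m := by
    rw [newton, Polynomial.natDegree_prod_of_monic _ _ fun _ _ => Polynomial.monic_X_sub_C _]
    simp
  have hm := (newton_monic u m).coeff_natDegree
  rwa [h] at hm

theorem newton_coeff_of_lt (u : ℕ → R) {m j : ℕ} (h : m < j) : (newton u m).coeff j = 0 :=
  Polynomial.coeff_eq_zero_of_natDegree_lt ((newton_natDegree_le u m).trans_lt h)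

theorem newton_add_mul {u : ℕ → R} {d : ℕ} (hu : Function.Periodic u d) (m q : ℕ) :
    newton u (m + d * q) = newton u d ^ q * newton u m := by
  induction q with
  | zero => simp
  | succ q ih =>
    have h : m + d * (q + 1) = d + (m + d * q) := by ring
    have hs : ∀ k, u (d + k) = u k := fun k => by rw [add_comm]; exact hu k
    rw [h, newton, Finset.prod_range_add]
    simp only [hs]
    rw [← newton, ← newton, ih]
    ring

open Classical in
theorem newton_eq_pow_count_mul (u : ℕ → R) (x : R) (m : ℕ) :
    newton u m = (Polynomial.X - Polynomial.C x) ^ Nat.count (u · = x) m *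
      ∏ j ∈ (Finset.range m).filter (¬ u · = x), (Polynomial.X - Polynomial.C (u j)) := by
  rw [newton, ← Finset.prod_filter_mul_prod_filter_not _ (u · = x)]
  congr 1
  rw [Nat.count_eq_card_filter_range, ← Finset.prod_const]
  refine Finset.prod_congr rfl fun j hj => ?_
  rw [(Finset.mem_filter.mp hj).2]

theorem taylor_X_sub_C_pow (x : R) (c : ℕ) :
    Polynomial.taylor x ((Polynomial.X - Polynomial.C x) ^ c) = Polynomial.X ^ c := by
  simp [Polynomial.taylor_apply]

-- The factor of index `m` makes the order of vanishing at `u m` exceed the count below `m`.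
open Classical in
theorem taylor_newton_coeff_eq_zero (u : ℕ → R) {m m' : ℕ} (h : m < m') :
    (Polynomial.taylor (u m) (newton u m')).coeff (Nat.count (u · = u m) m) = 0 := by
  rw [newton_eq_pow_count_mul u (u m) m', Polynomial.taylor_mul, taylor_X_sub_C_pow,
    Polynomial.coeff_X_pow_mul', if_neg]
  have : Nat.count (u · = u m) m < Nat.count (u · = u m) m' := Nat.count_strict_mono rfl h
  omega

open Classical in
theorem taylor_newton_coeff_count (u : ℕ → R) (m : ℕ) :
    (Polynomial.taylor (u m) (newton u m)).coeff (Nat.count (u · = u m) m) =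
      ∏ j ∈ (Finset.range m).filter (¬ u · = u m), (u m - u j) := by
  rw [newton_eq_pow_count_mul u (u m) m, Polynomial.taylor_mul, taylor_X_sub_C_pow,
    Polynomial.coeff_X_pow_mul', if_pos le_rfl, Nat.sub_self, Polynomial.taylor_coeff_zero,
    Polynomial.eval_prod]
  simp

theorem ConditionD.mem_nonZeroDivisors {X : Set R} (hX : ConditionD X) {a b : R} (ha : a ∈ X)
    (hb : b ∈ X) (hab : a ≠ b) : b - a ∈ nonZeroDivisors R := by
  rw [mem_nonZeroDivisors_iff_right]
  intro w hw
  by_contra h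
  exact hX a ha b hb hab ⟨w, h, by rw [mul_comm]; exact hw⟩

/-- Newton polynomials of a multiset with support `S` and multiplicities `ψ`, with points `v` and
orders `e` for which the coefficients of the Taylor expansions at the points are triangular. -/
theorem exists_newton_basis (S : Finset R) (ψ : R → ℕ) (hψ : ∀ u ∈ S, 0 < ψ u)
    (hS : S.Nonempty) (hD : ConditionD (S : Set R)) :
    ∃ (N : ℕ → Polynomial R) (v : ℕ → R) (e : ℕ → ℕ),
      (∀ m, (N m).coeff m = 1) ∧ (∀ m j, m < j → (N m).coeff j = 0) ∧
      (∀ m q, N (m + (∑ u ∈ S, ψ u) * q) =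
        (∏ u ∈ S, (Polynomial.X - Polynomial.C u) ^ ψ u) ^ q * N m) ∧
      (∀ m, v m ∈ S) ∧ (∀ m, e m / ψ (v m) = m / ∑ u ∈ S, ψ u) ∧
      (∀ m m', m < m' → (Polynomial.taylor (v m) (N m')).coeff (e m) = 0) ∧
      ∀ m, (Polynomial.taylor (v m) (N m)).coeff (e m) ∈ nonZeroDivisors R := by
  classical
  set M : Multiset R := ∑ u ∈ S, Multiset.replicate (ψ u) u with hMdef
  have hcard : M.card = ∑ u ∈ S, ψ u := by simp [hMdef, Multiset.card_sum]
  have hpos : 0 < M.card := by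
    rw [hcard]
    exact Finset.sum_pos hψ hS
  obtain ⟨u, hu, huM⟩ := exists_periodic_enumeration M hpos
  have hcount : ∀ x ∈ S, Nat.count (u · = x) M.card = ψ x := by
    intro x hx
    have h : M.count x = ψ x := by
      simp [hMdef, Multiset.count_sum', Multiset.count_replicate, hx]
    rw [← h, ← huM, Multiset.count_map, huM, Nat.count_eq_card_filter_range]
    simp only [Finset.card, Finset.filter_val, Finset.range_val, eq_comm]
  have hmem : ∀ m, u m ∈ S := by
    intro m
    have h : u (m % M.card) ∈ M := by
      have h' := Multiset.mem_map_of_mem u (Multiset.mem_range.mpr (Nat.mod_lt m hpos))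
      rwa [huM] at h'
    rw [hu.map_mod_nat m, hMdef, Multiset.mem_sum] at h
    obtain ⟨x, hx, h⟩ := h
    rwa [Multiset.eq_of_mem_replicate h]
  have hg : newton u M.card = ∏ x ∈ S, (Polynomial.X - Polynomial.C x) ^ ψ x := by
    have h : newton u M.card = (M.map fun x => Polynomial.X - Polynomial.C x).prod := by
      conv_rhs => rw [← huM, Multiset.map_map]
      rfl
    rw [h, hMdef, ← Multiset.coe_mapAddMonoidHom, map_sum, Multiset.prod_sum]
    simp
  refine ⟨newton u, u, fun m => Nat.count (u · = u m) m, newton_coeff_self u,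
    fun _ _ => newton_coeff_of_lt u, ?_, hmem, ?_, fun _ _ => taylor_newton_coeff_eq_zero u, ?_⟩
  · intro m q
    rw [← hcard, newton_add_mul hu, hg]
  · intro m
    rw [← hcard, ← hcount _ (hmem m)]
    exact count_div_of_periodic hpos hu m
  · intro m
    rw [taylor_newton_coeff_count]
    refine prod_mem fun j hj => ?_
    exact hD.mem_nonZeroDivisors (hmem j) (hmem m) (Finset.mem_filter.mp hj).2

end Univariate

theorem exists_le_sum_eq {ι : Type*} [Fintype ι] {t : ℕ} (α : ι →₀ ℕ) (h : t ≤ ∑ i, α i) :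
    ∃ γ : ι →₀ ℕ, γ ≤ α ∧ ∑ i, γ i = t := by
  obtain ⟨γ, hγ, hγt⟩ := Finsupp.exists_le_degree_eq α t (by rwa [Finsupp.degree_eq_sum])
  exact ⟨γ, hγ, by rw [← hγt, Finsupp.degree_eq_sum]⟩

/-! ### Products in separate variables and expansions -/

section Multivariate

variable {R : Type*} [CommRing R] {n : ℕ}

/-- The product `∏_i q_i(x_i)` of univariate polynomials in separate variables. -/
noncomputable def sepProd (q : Fin n → Polynomial R) : MvPolynomial (Fin n) R :=
  ∏ i, Polynomial.aeval (X i) (q i)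

theorem coeff_sepProd (q : Fin n → Polynomial R) (β : Fin n →₀ ℕ) :
    coeff β (sepProd q) = ∏ i, (q i).coeff (β i) := by
  classical
  have hexp : ∀ i, Polynomial.aeval (X i : MvPolynomial (Fin n) R) (q i) =
      ∑ j ∈ Finset.range ((q i).natDegree + 1), C ((q i).coeff j) * X i ^ j := fun i => by
    rw [Polynomial.aeval_eq_sum_range]
    simp [smul_eq_C_mul]
  have hterm : ∀ p : Fin n → ℕ,
      ∏ i, (C ((q i).coeff (p i)) * X i ^ p i : MvPolynomial (Fin n) R) =
        monomial (Finsupp.equivFunOnFinite.symm p) (∏ i, (q i).coeff (p i)) := fun p => by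
    rw [Finset.prod_mul_distrib, ← map_prod, monomial_eq, Finsupp.prod_fintype _ _ (by simp)]
    simp
  simp only [sepProd, hexp]
  rw [Finset.prod_univ_sum, coeff_sum]
  simp only [hterm, coeff_monomial]
  rw [Finset.sum_eq_single (β : Fin n → ℕ)]
  · simp
  · intro p _ hp
    rw [if_neg]
    rintro rfl
    exact hp (by simp)
  · intro hβ
    obtain ⟨i, hi⟩ : ∃ i, (q i).natDegree < β i := by
      by_contra! hc
      exact hβ (Fintype.mem_piFinset.mpr fun i => by simpa [Nat.lt_succ_iff] using hc i)
    rw [if_pos (by simp)]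
    exact Finset.prod_eq_zero (Finset.mem_univ i) (Polynomial.coeff_eq_zero_of_natDegree_lt hi)

theorem sepProd_mul (p q : Fin n → Polynomial R) :
    sepProd (fun i => p i * q i) = sepProd p * sepProd q := by
  simp [sepProd, Finset.prod_mul_distrib]

theorem shift_sepProd (a : Fin n → R) (q : Fin n → Polynomial R) :
    shift a (sepProd q) = sepProd fun i => Polynomial.taylor (a i) (q i) := by
  simp only [shift, sepProd, map_prod]
  refine Finset.prod_congr rfl fun i _ => ?_
  rw [← Polynomial.aeval_algHom_apply, aeval_X, Polynomial.taylor_apply, Polynomial.aeval_comp]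
  simp [algebraMap_eq]

/-- The univariate polynomial `∏_{u ∈ S} (X - u) ^ ψ(u)`. -/
noncomputable def rootPoly (S : Finset R) (ψ : R → ℕ) : Polynomial R :=
  ∏ u ∈ S, (Polynomial.X - Polynomial.C u) ^ ψ u

theorem rootPoly_monic (S : Finset R) (ψ : R → ℕ) : (rootPoly S ψ).Monic :=
  Polynomial.monic_prod_of_monic _ _ fun _ _ => (Polynomial.monic_X_sub_C _).pow _

theorem rootPoly_natDegree [Nontrivial R] (S : Finset R) (ψ : R → ℕ) :
    (rootPoly S ψ).natDegree = ∑ u ∈ S, ψ u := by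
  rw [rootPoly, Polynomial.natDegree_prod_of_monic _ _
    fun _ _ => (Polynomial.monic_X_sub_C _).pow _]
  simp [(Polynomial.monic_X_sub_C _).natDegree_pow]

theorem rootPoly_pow_natDegree [Nontrivial R] (S : Finset R) (ψ : R → ℕ) (q : ℕ) :
    (rootPoly S ψ ^ q).natDegree = (∑ u ∈ S, ψ u) * q := by
  rw [(rootPoly_monic S ψ).natDegree_pow, rootPoly_natDegree, mul_comm]

theorem multisetPoly_eq_aeval (S : Fin n → Finset R) (ψ : Fin n → R → ℕ) (k : Fin n) :
    multisetPoly S ψ k = Polynomial.aeval (X k) (rootPoly (S k) (ψ k)) := by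
  simp [multisetPoly, rootPoly, algebraMap_eq]

theorem prodPow_multisetPoly (S : Fin n → Finset R) (ψ : Fin n → R → ℕ) (α : Fin n →₀ ℕ) :
    prodPow (multisetPoly S ψ) α = sepProd fun k => rootPoly (S k) (ψ k) ^ α k := by
  simp [prodPow, sepProd, multisetPoly_eq_aeval]

theorem le_of_mem_support_prodPow (S : Fin n → Finset R) (ψ : Fin n → R → ℕ)
    {α ε : Fin n →₀ ℕ} (h : ε ∈ (prodPow (multisetPoly S ψ) α).support) (k : Fin n) :
    ε k ≤ (∑ u ∈ S k, ψ k u) * α k := by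
  have : Nontrivial R := by
    by_contra hR
    rw [not_nontrivial_iff_subsingleton] at hR
    exact mem_support_iff.mp h (Subsingleton.elim _ _)
  rw [mem_support_iff, prodPow_multisetPoly, coeff_sepProd] at h
  rw [← rootPoly_pow_natDegree]
  exact Polynomial.le_natDegree_of_ne_zero fun h0 => h (Finset.prod_eq_zero (Finset.mem_univ k) h0)

theorem mem_support_prodPow [Nontrivial R] (S : Fin n → Finset R) (ψ : Fin n → R → ℕ)
    {α ε : Fin n →₀ ℕ} (h : ∀ k, ε k = (∑ u ∈ S k, ψ k u) * α k) :
    ε ∈ (prodPow (multisetPoly S ψ) α).support := by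
  rw [mem_support_iff, prodPow_multisetPoly, coeff_sepProd]
  have h1 : ∀ k, (rootPoly (S k) (ψ k) ^ α k).coeff (ε k) = 1 := fun k => by
    rw [h k, ← rootPoly_pow_natDegree]
    exact ((rootPoly_monic _ _).pow _).coeff_natDegree
  simp [h1]

/-- Polynomials with one monic member for each multidegree expand any polynomial with indices
below its support. -/
theorem exists_expansion (N : (Fin n →₀ ℕ) → MvPolynomial (Fin n) R)
    (h1 : ∀ β, coeff β (N β) = 1) (h0 : ∀ β γ, coeff γ (N β) ≠ 0 → γ ≤ β)
    (f : MvPolynomial (Fin n) R) :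
    ∃ c : (Fin n →₀ ℕ) →₀ R, f = ∑ β ∈ c.support, C (c β) * N β ∧
      ∀ β ∈ c.support, β ∈ lowerClosure (f.support : Set (Fin n →₀ ℕ)) := by
  classical
  have hmon : ∀ β, monomial β (1 : R) ∈ Submodule.span R (N '' Set.Iic β) := by
    intro β
    induction β using WellFoundedLT.induction with
    | ind β ih =>
      have hN : N β = monomial β 1 + ∑ γ ∈ (N β).support.erase β, monomial γ (coeff γ (N β)) := by
        by_cases hβ : β ∈ (N β).support
        · conv_lhs => rw [(N β).as_sum, ← Finset.add_sum_erase _ _ hβ, h1]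
        -- The coefficient at `β` is `1`, so this case forces `1 = 0` in `R`.
        · rw [Finset.erase_eq_of_notMem hβ, ← (N β).as_sum]
          have : (1 : R) = 0 := by rw [← h1 β]; exact notMem_support_iff.mp hβ
          simp [this]
      rw [eq_sub_of_add_eq hN.symm]
      refine sub_mem (Submodule.subset_span ⟨β, Set.mem_Iic.mpr le_rfl, rfl⟩) (sum_mem fun γ hγ => ?_)
      obtain ⟨hne, hγ⟩ := Finset.mem_erase.mp hγ
      have hle := h0 β γ (mem_support_iff.mp hγ)
      rw [← mul_one (coeff γ (N β)), ← smul_eq_mul, ← smul_monomial]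
      refine Submodule.smul_mem _ _ (Submodule.span_mono ?_ (ih γ (lt_of_le_of_ne hle hne)))
      exact Set.image_mono (Set.Iic_subset_Iic.mpr hle)
  have hf : f ∈ Submodule.span R
      (N '' (lowerClosure (f.support : Set (Fin n →₀ ℕ)) : Set (Fin n →₀ ℕ))) := by
    have hsum := f.as_sum
    refine (congrArg (· ∈ Submodule.span R _) hsum).mpr (sum_mem fun β hβ => ?_)
    rw [← mul_one (coeff β f), ← smul_eq_mul, ← smul_monomial]
    refine Submodule.smul_mem _ _ (Submodule.span_mono (Set.image_mono ?_) (hmon β))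
    exact fun γ hγ => ⟨β, hβ, hγ⟩
  obtain ⟨c, hc, hcf⟩ := (Finsupp.mem_span_image_iff_linearCombination R).mp hf
  refine ⟨c, ?_, fun β hβ => hc hβ⟩
  rw [← hcf, Finsupp.linearCombination_apply, Finsupp.sum]
  simp [smul_eq_C_mul]

/-! ### Membership in the ideal implies vanishing -/

theorem coeff_shift_eq_zero_of_dvd {a : Fin n → R} {f : MvPolynomial (Fin n) R}
    {δ β : Fin n →₀ ℕ} (h : ∏ i, (X i - C (a i)) ^ δ i ∣ f) (hβ : ¬ δ ≤ β) :
    coeff β (shift a f) = 0 := by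
  obtain ⟨q, rfl⟩ := h
  have hs : shift a (∏ i, (X i - C (a i)) ^ δ i) = monomial δ (1 : R) := by
    rw [monomial_eq, Finsupp.prod_fintype _ _ (by simp)]
    simp [shift, map_prod, algebraMap_eq]
  have hm : shift a ((∏ i, (X i - C (a i)) ^ δ i) * q) = monomial δ 1 * shift a q := by
    rw [← hs]
    exact map_mul _ _ _
  rw [hm, coeff_monomial_mul', if_neg hβ]

/-- If `ψ_i α_i ≤ β_i` for all `i`, then `∑ ⌊β_i / ψ_i⌋ ≥ t`. The exponent `α` may depend on the
point, which the counterexample for (3) needs. -/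
theorem vanishes_of_dvd {S : Fin n → Finset R} {ψ : Fin n → R → ℕ} {t : ℕ}
    (hψ : ∀ i, ∀ u ∈ S i, 0 < ψ i u) {f : MvPolynomial (Fin n) R}
    (h : ∀ a : Fin n → R, (∀ i, a i ∈ S i) → ∃ α : Fin n →₀ ℕ, ∑ i, α i = t ∧
      ∏ i, (X i - C (a i)) ^ (ψ i (a i) * α i) ∣ f) :
    Vanishes S ψ t f := by
  intro a ha β hβ
  obtain ⟨α, hα, hd⟩ := h a ha
  refine coeff_shift_eq_zero_of_dvd
    (δ := Finsupp.equivFunOnFinite.symm fun i => ψ i (a i) * α i) (by simpa using hd) fun hle => ?_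
  have h1 : ∑ i, α i ≤ ∑ i, β i / ψ i (a i) := Finset.sum_le_sum fun i _ => by
    rw [Nat.le_div_iff_mul_le (hψ i _ (ha i)), mul_comm]
    exact hle i
  omega

theorem vanishes_of_mem_idealI {S : Fin n → Finset R} {ψ : Fin n → R → ℕ} {t : ℕ}
    (hψ : ∀ i, ∀ u ∈ S i, 0 < ψ i u) {f : MvPolynomial (Fin n) R}
    (hf : f ∈ idealI t (multisetPoly S ψ)) : Vanishes S ψ t f := by
  induction hf using Submodule.span_induction with
  | mem q hq =>
    obtain ⟨α, hα, rfl⟩ := hq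
    refine vanishes_of_dvd hψ fun a ha => ⟨α, hα, ?_⟩
    refine Finset.prod_dvd_prod_of_dvd _ _ fun i _ => ?_
    rw [pow_mul]
    exact pow_dvd_pow_of_dvd (Finset.dvd_prod_of_mem _ (ha i)) _
  | zero => intro a _ β _; simp [shift]
  | add p q _ _ hp hq =>
    intro a ha β hβ
    have hpa : shift a (p + q) = shift a p + shift a q := map_add _ _ _
    rw [hpa, coeff_add, hp a ha β hβ, hq a ha β hβ, add_zero]
  | smul r q _ hq =>
    classical
    intro a ha β hβ
    have hra : shift a (r • q) = shift a r * shift a q := map_mul _ _ _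
    rw [hra, coeff_mul]
    refine Finset.sum_eq_zero fun γ hγ => ?_
    have hle : ∀ i, γ.2 i ≤ β i := fun i => by
      rw [← Finset.HasAntidiagonal.mem_antidiagonal.mp hγ]
      exact Nat.le_add_left _ _
    have h1 : ∑ i, γ.2 i / ψ i (a i) ≤ ∑ i, β i / ψ i (a i) :=
      Finset.sum_le_sum fun i _ => Nat.div_le_div_right (hle i)
    rw [hq a ha γ.2 (by omega), mul_zero]

/-! ### Vanishing implies a representation with controlled support -/

theorem exists_representation {S : Fin n → Finset R} {ψ : Fin n → R → ℕ}
    (hψ : ∀ i, ∀ u ∈ S i, 0 < ψ i u) (hD : ∀ k, ConditionD (S k : Set R)) {t : ℕ}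
    {f : MvPolynomial (Fin n) R} (hf : Vanishes S ψ t f) :
    ∃ p : (Fin n →₀ ℕ) → MvPolynomial (Fin n) R,
      f = ∑ α ∈ expsOfSum n t, p α * prodPow (multisetPoly S ψ) α ∧
      ∀ α ∈ expsOfSum n t,
        ((p α).support : Set (Fin n →₀ ℕ)) +
            ((prodPow (multisetPoly S ψ) α).support : Set (Fin n →₀ ℕ)) ⊆
          (lowerClosure (f.support : Set (Fin n →₀ ℕ)) : Set (Fin n →₀ ℕ)) := by
  classical
  by_cases hS : ∀ k, (S k).Nonempty
  swap
  -- An empty `S k` gives `g_k = 1`, so `f` itself serves as the coefficient of `g_k^t`.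
  · obtain ⟨k, hk⟩ : ∃ k, S k = ∅ := by simpa using hS
    have hg : prodPow (multisetPoly S ψ) (Finsupp.single k t) = 1 := by
      refine Finset.prod_eq_one fun i _ => ?_
      rcases eq_or_ne i k with rfl | hi
      · simp [multisetPoly, hk]
      · simp [Finsupp.single_eq_of_ne hi]
    refine ⟨fun α => if α = Finsupp.single k t then f else 0, ?_, ?_⟩
    · have hmem : Finsupp.single k t ∈ expsOfSum n t := by
        rw [mem_expsOfSum]
        simp [Finsupp.single_apply]
      simp [ite_mul, hmem, hg]
    · rintro α - _ ⟨δ, hδ, ε, hε, rfl⟩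
      by_cases hα : α = Finsupp.single k t
      · subst hα
        rw [hg] at hε
        have hε0 : ε = 0 := by
          by_contra hne
          exact mem_support_iff.mp hε (by rw [coeff_one, if_neg (Ne.symm hne)])
        exact ⟨δ, by simpa using hδ, by simp [hε0]⟩
      · simp [hα] at hδ
  · choose N v e h1 h0 hN hv he hlt hreg using
      fun k => exists_newton_basis (S k) (ψ k) (hψ k) (hS k) (hD k)
    set d : Fin n → ℕ := fun k => ∑ u ∈ S k, ψ k u with hd
    set B : (Fin n →₀ ℕ) → MvPolynomial (Fin n) R := fun β => sepProd fun i => N i (β i) with hB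
    have hB1 : ∀ β, coeff β (B β) = 1 := fun β => by simp [hB, coeff_sepProd, h1]
    have hB0 : ∀ β γ, coeff γ (B β) ≠ 0 → γ ≤ β := fun β γ h i => by
      by_contra! hi
      rw [hB, coeff_sepProd] at h
      exact h (Finset.prod_eq_zero (Finset.mem_univ i) (h0 i _ _ hi))
    obtain ⟨c, hc, hcf⟩ := exists_expansion B hB1 hB0 f
    -- Test `f` at the node and order attached to `β`: terms with `γ < β` vanish by induction, those
    -- with some `γ_i > β_i` by triangularity, leaving `c β` times a regular element.
    have hsmall : ∀ β : Fin n →₀ ℕ, ∑ i, β i / d i < t → c β = 0 := by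
      intro β
      induction β using WellFoundedLT.induction with
      | ind β ih =>
        intro hβ
        set a : Fin n → R := fun i => v i (β i) with ha
        set ε : Fin n →₀ ℕ := Finsupp.equivFunOnFinite.symm fun i => e i (β i) with hε
        have hz : coeff ε (shift a f) = 0 := by
          refine hf a (fun i => hv i _) ε ?_
          have : ∑ i, ε i / ψ i (a i) = ∑ i, β i / d i :=
            Finset.sum_congr rfl fun i _ => he i (β i)
          omega
        have hcoeff : ∀ γ, coeff ε (shift a (C (c γ) * B γ)) =
            c γ * ∏ i, (Polynomial.taylor (v i (β i)) (N i (γ i))).coeff (e i (β i)) := fun γ => by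
          have : shift a (C (c γ) * B γ) = C (c γ) * shift a (B γ) := by
            simp [shift, algebraMap_eq]
          rw [this, coeff_C_mul, hB, shift_sepProd, coeff_sepProd]
          rfl
        have hsum : shift a f = ∑ γ ∈ c.support, shift a (C (c γ) * B γ) := by
          conv_lhs => rw [hc]
          exact map_sum _ _ _
        rw [hsum, coeff_sum, Finset.sum_eq_single β, hcoeff] at hz
        · exact mem_nonZeroDivisors_iff_right.mp (prod_mem fun i _ => hreg i (β i)) _ hz
        · intro γ _ hγ
          rw [hcoeff]
          by_cases hle : γ ≤ β
          · have hsl : ∑ i, γ i / d i ≤ ∑ i, β i / d i :=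
              Finset.sum_le_sum fun i _ => Nat.div_le_div_right (hle i)
            rw [ih γ (lt_of_le_of_ne hle hγ) (hsl.trans_lt hβ), zero_mul]
          · obtain ⟨i, hi⟩ : ∃ i, β i < γ i := by
              by_contra! h
              exact hle h
            rw [Finset.prod_eq_zero (Finset.mem_univ i) (hlt i _ _ hi), mul_zero]
        · intro hβs
          rw [hcoeff, Finsupp.notMem_support_iff.mp hβs, zero_mul]
    have hquot : ∀ β : Fin n →₀ ℕ, ∃ γ : Fin n →₀ ℕ, β ∈ c.support →
        (∀ i, d i * γ i ≤ β i) ∧ ∑ i, γ i = t := by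
      intro β
      by_cases hβ : β ∈ c.support
      · have hle : t ≤ ∑ i, β i / d i := by
          by_contra! h
          exact Finsupp.mem_support_iff.mp hβ (hsmall β h)
        obtain ⟨γ, hγ, hγt⟩ := exists_le_sum_eq
          (Finsupp.equivFunOnFinite.symm fun i => β i / d i) hle
        refine ⟨γ, fun _ => ⟨fun i => ?_, hγt⟩⟩
        exact (Nat.mul_le_mul_left _ (hγ i)).trans (Nat.mul_div_le _ _)
      -- A default value: `φ` matters only on the support of `c`.
      · exact ⟨0, fun h => absurd h hβ⟩
    choose φ hφ using hquot
    set ρ : (Fin n →₀ ℕ) → MvPolynomial (Fin n) R :=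
      fun β => sepProd fun i => N i (β i - d i * φ β i) with hρ
    have hfac : ∀ β ∈ c.support, B β = ρ β * prodPow (multisetPoly S ψ) (φ β) := by
      intro β hβ
      rw [prodPow_multisetPoly, hρ, ← sepProd_mul]
      simp only [hB]
      congr 1
      funext i
      rw [mul_comm, rootPoly, ← hN i, Nat.sub_add_cancel ((hφ β hβ).1 i)]
    refine ⟨fun α => ∑ β ∈ c.support with φ β = α, C (c β) * ρ β, ?_, ?_⟩
    · conv_lhs => rw [hc]
      rw [← Finset.sum_fiberwise_of_maps_to (t := expsOfSum n t) (g := φ)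
        fun β hβ => mem_expsOfSum.mpr (hφ β hβ).2]
      refine Finset.sum_congr rfl fun α _ => ?_
      rw [Finset.sum_mul]
      refine Finset.sum_congr rfl fun β hβ => ?_
      obtain ⟨hβc, rfl⟩ := Finset.mem_filter.mp hβ
      rw [hfac β hβc, mul_assoc]
    · rintro α - _ ⟨δ, hδ, ε, hε, rfl⟩
      obtain ⟨β, hβ, hδβ⟩ : ∃ β ∈ c.support.filter (φ · = α), coeff δ (C (c β) * ρ β) ≠ 0 := by
        by_contra! h
        refine mem_support_iff.mp hδ ?_
        rw [coeff_sum]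
        exact Finset.sum_eq_zero h
      obtain ⟨hβc, rfl⟩ := Finset.mem_filter.mp hβ
      refine (lowerClosure _).lower (a := β) (fun i => ?_) (hcf β hβc)
      have hδi : δ i ≤ β i - d i * φ β i := by
        by_contra! hi
        refine hδβ ?_
        rw [coeff_C_mul, hρ, coeff_sepProd, Finset.prod_eq_zero (Finset.mem_univ i) (h0 i _ _ hi),
          mul_zero]
      have hεi : ε i ≤ d i * φ β i := le_of_mem_support_prodPow S ψ hε i
      have hβi := (hφ β hβc).1 i
      simp only [Finsupp.add_apply]
      omega

/-- Write `β = δ + ε` with `δ`, `ε` in the supports of some `p α` and its product. Replacing `ε` by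
the top exponent `μ ≥ ε` of the product stays in `Δ(supp f)`, so maximality forces `δ + μ ≤ β`. -/
theorem exists_le_of_maximal {S : Fin n → Finset R} {ψ : Fin n → R → ℕ} {t : ℕ}
    {f : MvPolynomial (Fin n) R} {p : (Fin n →₀ ℕ) → MvPolynomial (Fin n) R}
    (hp : f = ∑ α ∈ expsOfSum n t, p α * prodPow (multisetPoly S ψ) α)
    (hsupp : ∀ α ∈ expsOfSum n t,
      ((p α).support : Set (Fin n →₀ ℕ)) +
          ((prodPow (multisetPoly S ψ) α).support : Set (Fin n →₀ ℕ)) ⊆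
        (lowerClosure (f.support : Set (Fin n →₀ ℕ)) : Set (Fin n →₀ ℕ)))
    {β : Fin n →₀ ℕ} (hβ : Maximal (fun δ => δ ∈ f.support) β) :
    ∃ γ : Fin n →₀ ℕ, ∑ i, γ i = t ∧ ∀ k, (∑ u ∈ S k, ψ k u) * γ k ≤ β k := by
  classical
  have : Nontrivial R := ⟨⟨_, _, mem_support_iff.mp hβ.prop⟩⟩
  obtain ⟨α, hα, hne⟩ : ∃ α ∈ expsOfSum n t,
      coeff β (p α * prodPow (multisetPoly S ψ) α) ≠ 0 := by
    by_contra! h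
    refine mem_support_iff.mp hβ.prop ?_
    rw [hp, coeff_sum]
    exact Finset.sum_eq_zero h
  obtain ⟨δ, hδ, ε, hε, rfl⟩ := Finset.mem_add.mp (support_mul _ _ (mem_support_iff.mpr hne))
  refine ⟨α, mem_expsOfSum.mp hα, fun k => ?_⟩
  set μ : Fin n →₀ ℕ := Finsupp.equivFunOnFinite.symm fun k => (∑ u ∈ S k, ψ k u) * α k with hμ
  have hμs : μ ∈ (prodPow (multisetPoly S ψ) α).support := mem_support_prodPow S ψ fun _ => rfl
  have hεμ : ε ≤ μ := fun i => le_of_mem_support_prodPow S ψ hε i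
  obtain ⟨ζ, hζ, hle⟩ := hsupp α hα (Set.add_mem_add hδ hμs)
  have hle' : δ + μ ≤ δ + ε := hle.trans (hβ.le_of_ge hζ ((add_le_add_right hεμ δ).trans hle))
  exact (le_add_self.trans hle' : μ ≤ δ + ε) k

/-! ### Necessity of Condition (D) -/

theorem conditionD_of_vanishes_imp_mem {S : Fin n → Finset R} {ψ : Fin n → R → ℕ}
    (hψ : ∀ i, ∀ u ∈ S i, 0 < ψ i u) (hS : ∃ a : Fin n → R, ∀ i, a i ∈ S i) {t : ℕ} (ht : 1 ≤ t)
    (h : ∀ f : MvPolynomial (Fin n) R, Vanishes S ψ t f → f ∈ idealI t (multisetPoly S ψ))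
    (k : Fin n) : ConditionD (S k : Set R) := by
  classical
  rintro a ha b hb hab ⟨w, hw, hwab⟩
  have : Nontrivial R := ⟨⟨_, _, hw⟩⟩
  obtain ⟨s, rfl⟩ := Nat.exists_eq_add_of_le' ht
  obtain ⟨z, hz⟩ := hS
  set E : Polynomial R := ∏ u ∈ (S k).erase b, (Polynomial.X - Polynomial.C u) ^ ψ k u with hE
  -- `F` is `g_k^(s+1)` with one factor `X - b` removed.
  set F : Polynomial R := (Polynomial.X - Polynomial.C b) ^ (ψ k b - 1) * E *
    rootPoly (S k) (ψ k) ^ s with hF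
  have hbpos := hψ k b hb
  have hEmonic : E.Monic :=
    Polynomial.monic_prod_of_monic _ _ fun _ _ => (Polynomial.monic_X_sub_C _).pow _
  have hFmonic : F.Monic :=
    (((Polynomial.monic_X_sub_C b).pow _).mul hEmonic).mul ((rootPoly_monic _ _).pow _)
  have hFmul : (Polynomial.X - Polynomial.C b) * F = rootPoly (S k) (ψ k) ^ (s + 1) := by
    have : rootPoly (S k) (ψ k) = (Polynomial.X - Polynomial.C b) ^ (ψ k b - 1 + 1) * E := by
      rw [Nat.sub_add_cancel hbpos, rootPoly, hE,
        Finset.mul_prod_erase _ (fun u => (Polynomial.X - Polynomial.C u) ^ ψ k u) hb]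
    rw [hF, pow_succ (rootPoly _ _)]
    conv_rhs => rw [this]
    conv_lhs => rw [this]
    ring
  have hdvd : ∀ u ∈ S k, (Polynomial.X - Polynomial.C u) ^ (ψ k u * (s + 1)) ∣
      Polynomial.C w * F := by
    have hpow : ∀ u ∈ S k, (Polynomial.X - Polynomial.C u) ^ (ψ k u * s) ∣
        rootPoly (S k) (ψ k) ^ s := fun u hu => by
      rw [pow_mul]
      exact pow_dvd_pow_of_dvd (Finset.dvd_prod_of_mem _ hu) _
    intro u hu
    rw [Nat.mul_succ, add_comm, pow_add, hF, ← mul_assoc]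
    refine mul_dvd_mul ?_ (hpow u hu)
    rcases eq_or_ne u b with rfl | hub
    · have hw' : Polynomial.C w * (Polynomial.X - Polynomial.C a) =
          Polynomial.C w * (Polynomial.X - Polynomial.C u) := by
        have : Polynomial.C w * Polynomial.C a = Polynomial.C w * Polynomial.C u := by
          rw [← map_mul, ← map_mul]
          congr 1
          linear_combination -hwab
        rw [mul_sub, mul_sub, this]
      have haE : Polynomial.X - Polynomial.C a ∣ E :=
        (dvd_pow_self _ (hψ k a ha).ne').trans
          (Finset.dvd_prod_of_mem _ (Finset.mem_erase.mpr ⟨hab, ha⟩))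
      obtain ⟨q, hq⟩ := haE
      refine ⟨Polynomial.C w * q, ?_⟩
      conv_rhs => rw [← Nat.sub_add_cancel hbpos, pow_succ]
      rw [hq]
      linear_combination (Polynomial.X - Polynomial.C u) ^ (ψ k u - 1) * q * hw'
    · exact ((Finset.dvd_prod_of_mem _ (Finset.mem_erase.mpr ⟨hub, hu⟩)).mul_left _).mul_left _
  have hmem := h (Polynomial.aeval (X k) (Polynomial.C w * F)) (vanishes_of_dvd hψ fun x hx => by
    refine ⟨Finsupp.single k (s + 1), ?_, ?_⟩
    · rw [Finset.sum_eq_single k (fun i _ hi => Finsupp.single_eq_of_ne hi) (by simp),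
        Finsupp.single_eq_same]
    rw [Finset.prod_eq_single k (fun i _ hi => by simp [Finsupp.single_eq_of_ne hi]) (by simp)]
    have := map_dvd (Polynomial.aeval (X k : MvPolynomial (Fin n) R)) (hdvd (x k) (hx k))
    simpa [algebraMap_eq] using this)
  -- Evaluating the other variables at `z` kills every `g_i` with `i ≠ k`, so only the generator
  -- `g_k^(s+1)` survives.
  set φ : MvPolynomial (Fin n) R →ₐ[R] Polynomial R :=
    aeval fun i => if i = k then Polynomial.X else Polynomial.C (z i) with hφ
  have hφk : ∀ q : Polynomial R, φ (Polynomial.aeval (X k) q) = q := fun q => by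
    rw [← Polynomial.aeval_algHom_apply]
    simp [hφ]
  have hideal : idealI (s + 1) (multisetPoly S ψ) ≤
      (Ideal.span {rootPoly (S k) (ψ k) ^ (s + 1)}).comap φ := by
    refine Ideal.span_le.mpr ?_
    rintro _ ⟨α, hα, rfl⟩
    rw [SetLike.mem_coe, Ideal.mem_comap, prodPow, map_prod, Ideal.mem_span_singleton]
    by_cases hex : ∃ i, i ≠ k ∧ α i ≠ 0
    · obtain ⟨i, hik, hi⟩ := hex
      rw [Finset.prod_eq_zero (Finset.mem_univ i)]
      · exact dvd_zero _
      · have h0 : φ (multisetPoly S ψ i) = 0 := by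
          rw [multisetPoly, map_prod]
          refine Finset.prod_eq_zero (hz i) ?_
          have hφi : φ (X i - C (z i)) = 0 := by
            rw [map_sub, hφ, aeval_X, if_neg hik, aeval_C]
            simp
          rw [map_pow, hφi, zero_pow (hψ i _ (hz i)).ne']
        rw [map_pow, h0, zero_pow hi]
    · push Not at hex
      have hαk : α k = s + 1 := by
        rw [← hα, Finset.sum_eq_single k (fun i _ hi => hex i hi) (by simp)]
      rw [Finset.prod_eq_single k (fun i _ hi => by simp [hex i hi]) (by simp), hαk, map_pow,
        multisetPoly_eq_aeval, hφk]
  have hspan := hideal hmem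
  rw [Ideal.mem_comap, hφk, Ideal.mem_span_singleton] at hspan
  have hzero : Polynomial.C w * F = 0 := by
    by_contra hne
    refine ((rootPoly_monic (S k) (ψ k)).pow (s + 1)).not_dvd_of_natDegree_lt hne ?_ hspan
    rw [← hFmul, (Polynomial.monic_X_sub_C b).natDegree_mul hFmonic, Polynomial.natDegree_X_sub_C]
    have := Polynomial.natDegree_C_mul_le w F
    omega
  have hlead := congrArg (Polynomial.coeff · F.natDegree) hzero
  simp only [Polynomial.coeff_C_mul, hFmonic.coeff_natDegree, mul_one,
    Polynomial.coeff_zero] at hlead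
  exact hw hlead

end Multivariate

end MultisetNSS

theorem theorem5p2 {R : Type*} [CommRing R] (n : ℕ)
    (S : Fin n → Finset R) (ψ : Fin n → R → ℕ) (hψ : ∀ i, ∀ u ∈ S i, 0 < ψ i u) :
    ((∀ k, ConditionD (S k : Set R)) → ∀ (t : ℕ) (f : MvPolynomial (Fin n) R),
      f ∈ idealI t (multisetPoly S ψ) ↔ Vanishes S ψ t f) ∧
    ((∀ k, ConditionD (S k : Set R)) → ∀ (t : ℕ) (f : MvPolynomial (Fin n) R),
      Vanishes S ψ t f →
        (∃ p : (Fin n →₀ ℕ) → MvPolynomial (Fin n) R,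
          f = ∑ α ∈ expsOfSum n t, p α * prodPow (multisetPoly S ψ) α ∧
          ∀ α ∈ expsOfSum n t,
            ((p α).support : Set (Fin n →₀ ℕ)) +
                ((prodPow (multisetPoly S ψ) α).support : Set (Fin n →₀ ℕ)) ⊆
              (lowerClosure (f.support : Set (Fin n →₀ ℕ)) : Set (Fin n →₀ ℕ))) ∧
        ∀ β : Fin n →₀ ℕ, Maximal (fun δ => δ ∈ f.support) β →
          ∃ γ : Fin n →₀ ℕ, ∑ i, γ i = t ∧ ∀ k, (∑ u ∈ S k, ψ k u) * γ k ≤ β k) ∧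
    ((∃ a : Fin n → R, ∀ i, a i ∈ S i) → ∀ t : ℕ, 1 ≤ t →
      (∀ f : MvPolynomial (Fin n) R, Vanishes S ψ t f → f ∈ idealI t (multisetPoly S ψ)) →
      ∀ k, ConditionD (S k : Set R)) := by
  refine ⟨fun hD t f => ⟨vanishes_of_mem_idealI hψ, fun hf => ?_⟩, fun hD t f hf => ?_,
    fun hS t ht h => conditionD_of_vanishes_imp_mem hψ hS ht h⟩
  · obtain ⟨p, hp, -⟩ := exists_representation hψ hD hf
    rw [hp]
    exact sum_mem fun α hα => Ideal.mul_mem_left _ _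
      (Ideal.subset_span ⟨α, mem_expsOfSum.mp hα, rfl⟩)
  · obtain ⟨p, hp, hsupp⟩ := exists_representation hψ hD hf
    exact ⟨⟨p, hp, hsupp⟩, fun β hβ => exists_le_of_maximal hp hsupp hβ⟩
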